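/- Let $X$ be a countable (finite or infinite) set and let $k:X\times X\to\mathbb R$ satisfy $k(x,y)\ge 0$ for $x\ne y$ and $\sum_{y}k(x,y)=0$ (an absolutely convergent sum) for every $x\in X$. Put $Lf(x)=\sum_{y}k(x,y)(f(y)-f(x))$, $M_1(x)=\sum_{y\neq x}k(x,y)$, $M_2(x)=\sum_{y\ne x}k(x,y)M_1(y)$ and $M_{1,\sup}=\sup_{x}M_1(x)\in[0,\infty]$. Assume that $M_2(x)<\infty$ for every $x$, that the continuous-time Markov chain with transition rates $k$ (the minimal chain, generated by $L$) is irreducible, and that $\mu$ is a probability measure on $X$ with $\mu(\{x\})k(x,y)=\mu(\{y\})k(y,x)$ for all $x,y\in X$. For continuous $H:\mathbb R\to\mathbb R$ let $\Psi_H(f)(x)=\sum_y k(x,y)H(f(y)-f(x))$ and $B_H(f,g)(x)=\sum_y k(x,y)H(f(y)-f(x))(g(y)-g(x))$. Let $\Upsilon(r)=e^r-r-1$ and $\Psi_{2,\Upsilon}(f)=\tfrac12\big(L\Psi_\Upsilon(f)-B_{\Upsilon'}(f,Lf)\big)$. For $F:[0,\infty)\to[0,\infty)$ set $F_0=F$ on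 $[0,\infty)$ and $F_0=0$ on $(-\infty,0)$. One says that $L$ satisfies $CD_\Upsilon(\kappa,F)$ if $$\Psi_{2,\Upsilon}(f)(x)\ \ge\ \kappa\,\Psi_\Upsilon(f)(x)+F_0\big(-Lf(x)\big)$$ for every bounded $f:X\to\mathbb R$ and every $x\in X$. Suppose that $M_1\in\ell^2(\mu)$, that $M_2\in\ell^1(\mu)$, that the Markov chain is positive recurrent (every state is absorbing or has finite expected return time), and that $L$ satisfies $CD_\Upsilon(\kappa,F)$ with $\kappa>0$ and $F(r)=\frac{r^{1+\delta}}{n}$, $r\ge0$, for some $\delta\ge1$ and $n\in(0,\infty)$. Then $X$ is finite if and only if either $\delta>1$, or $\delta=1$ and $M_{1,\sup}<\infty$. -/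

import Mathlib

open MeasureTheory
open scoped ENNReal NNReal

noncomputable section

namespace MarkovCD

variable {X : Type*}

/-- `k` is a (conservative) matrix of jump rates on `X`: nonnegative off the diagonal, and every
row is (absolutely) summable with sum zero. -/
structure IsRateMatrix (k : X → X → ℝ) : Prop where
  nonneg : ∀ x y, x ≠ y → 0 ≤ k x y
  row_sum : ∀ x, HasSum (k x) 0

/-- Irreducibility: any state can be reached from any other by jumps of positive rate. (For a
rate matrix the diagonal is nonpositive, so `0 < k a b` forces `a ≠ b`.) -/
def Irreducible (k : X → X → ℝ) : Prop :=
  ∀ x y, Relation.ReflTransGen (fun a b => 0 < k a b) x y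

/-- `M₁(x) = ∑_{y ≠ x} k(x,y)`, the total jump rate at `x`. -/
def M₁ (k : X → X → ℝ) (x : X) : ℝ :=
  ∑' y : ({x}ᶜ : Set X), k x y

/-- `M₂(x) = ∑_{y ≠ x} k(x,y) ∑_{z ≠ y} k(y,z)`. -/
def M₂ (k : X → X → ℝ) (x : X) : ℝ :=
  ∑' y : ({x}ᶜ : Set X), k x y * M₁ k y

/-- `M₂(x) < ∞` at every `x`. -/
def M₂Finite (k : X → X → ℝ) : Prop :=
  ∀ x, Summable fun y : ({x}ᶜ : Set X) => k x y * M₁ k y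

/-- `M_{1,sup} = sup_x M₁(x)`, with values in `[0,∞]`. -/
def M₁sup (k : X → X → ℝ) : ℝ≥0∞ :=
  ⨆ x, ENNReal.ofReal (M₁ k x)

/-- The generator `L f(x) = ∑_y k(x,y) (f(y) - f(x))`. -/
def generator (k : X → X → ℝ) (f : X → ℝ) (x : X) : ℝ :=
  ∑' y, k x y * (f y - f x)

/-- `Ψ_H(f)(x) = ∑_y k(x,y) H(f(y) - f(x))`. -/
def Psi (k : X → X → ℝ) (H : ℝ → ℝ) (f : X → ℝ) (x : X) : ℝ :=
  ∑' y, k x y * H (f y - f x)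

/-- `B_H(f,g)(x) = ∑_y k(x,y) H(f(y) - f(x)) (g(y) - g(x))`. -/
def B (k : X → X → ℝ) (H : ℝ → ℝ) (f g : X → ℝ) (x : X) : ℝ :=
  ∑' y, k x y * H (f y - f x) * (g y - g x)

/-- `Ψ_{2,H}(f) = (L Ψ_H(f) - B_{H'}(f, L f)) / 2`. -/
def Psi₂ (k : X → X → ℝ) (H : ℝ → ℝ) (f : X → ℝ) (x : X) : ℝ :=
  (1 / 2) * (generator k (Psi k H f) x - B k (deriv H) f (generator k f) x)

/-- `Υ(r) = e^r - r - 1`. -/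
def Upsilon (r : ℝ) : ℝ := Real.exp r - r - 1

/-- The trivial extension `F₀` of a function `F` on `[0,∞)`: equal to `F` on `[0,∞)` and to `0`
on `(-∞,0)`. -/
def trivialExtension (F : ℝ → ℝ) (r : ℝ) : ℝ := if 0 ≤ r then F r else 0

/-- The condition `CD_Υ(κ,F)`; only the values of `F` on `[0,∞)` matter. -/
def CDUpsilon (k : X → X → ℝ) (κ : ℝ) (F : ℝ → ℝ) : Prop :=
  ∀ f : X → ℝ, (∃ C, ∀ x, |f x| ≤ C) → ∀ x,
    κ * Psi k Upsilon f x + trivialExtension F (-generator k f x) ≤ Psi₂ k Upsilon f x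

/-- Detailed balance `μ({x}) k(x,y) = μ({y}) k(y,x)`. -/
def DetailedBalance [MeasurableSpace X] (k : X → X → ℝ) (μ : Measure X) : Prop :=
  ∀ x y, μ.real {x} * k x y = μ.real {y} * k y x

open Classical in
/-- The transition probabilities of the jump chain; a state of total rate `0` is absorbing. -/
def jumpProb (k : X → X → ℝ) (x y : X) : ℝ :=
  if M₁ k x = 0 then (if y = x then 1 else 0)
  else (if y = x then 0 else k x y / M₁ k x)

variable {Ω : Type*}

/-- The continuous-time Markov chain with rates `k`, described by its successive states `Y n`
and holding times `S n`. Under `P x` the chain starts in `x`, `Y` is a discrete-time Markov chain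
with transition probabilities `jumpProb k`, and, given `Y`, the holding times `S n` are independent
and exponential of parameter `M₁ (Y n)` (infinite if the parameter is `0`). -/
structure IsMarkovChain [MeasurableSpace X] [MeasurableSpace Ω] (k : X → X → ℝ)
    (P : X → Measure Ω) (Y : ℕ → Ω → X) (S : ℕ → Ω → ℝ≥0∞) : Prop where
  isProbabilityMeasure : ∀ x, IsProbabilityMeasure (P x)
  measurable_state : ∀ n, Measurable (Y n)
  measurable_holding : ∀ n, Measurable (S n)
  start : ∀ x, ∀ᵐ ω ∂(P x), Y 0 ω = x
  law : ∀ (n : ℕ) (c : ℕ → X) (t : ℕ → ℝ≥0),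
    P (c 0) {ω | ∀ i ≤ n, Y i ω = c i ∧ (t i : ℝ≥0∞) < S i ω} =
      ENNReal.ofReal
        ((∏ i ∈ Finset.range n, jumpProb k (c i) (c (i + 1))) *
          ∏ i ∈ Finset.range (n + 1), Real.exp (-(M₁ k (c i) * (t i : ℝ))))

/-- The time of the `n`-th jump. -/
def jumpTime (S : ℕ → Ω → ℝ≥0∞) (n : ℕ) (ω : Ω) : ℝ≥0∞ :=
  ∑ i ∈ Finset.range n, S i ω

open Classical in
/-- The chain `Z_t`: equal to `Y n` for `t` in `[J_n, J_{n+1})`, and in the cemetery `none` from the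
explosion time `sup_n J_n` on. -/
def chain (Y : ℕ → Ω → X) (S : ℕ → Ω → ℝ≥0∞) (t : ℝ≥0) (ω : Ω) : Option X :=
  if h : ∃ n, jumpTime S n ω ≤ t ∧ (t : ℝ≥0∞) < jumpTime S (n + 1) ω then
    some (Y h.choose ω)
  else none

/-- The first return time `inf {t ≥ J_1 : Z_t = x}`, infinite if there is no such `t`. -/
def returnTime (Y : ℕ → Ω → X) (S : ℕ → Ω → ℝ≥0∞) (x : X) (ω : Ω) : ℝ≥0∞ :=
  ⨅ (t : ℝ≥0) (_ : jumpTime S 1 ω ≤ t ∧ chain Y S t ω = some x), (t : ℝ≥0∞)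

/-- Positive recurrence: every state is absorbing or has finite expected return time. -/
def PositiveRecurrent [MeasurableSpace Ω] (k : X → X → ℝ)
    (P : X → Measure Ω) (Y : ℕ → Ω → X) (S : ℕ → Ω → ℝ≥0∞) : Prop :=
  ∀ x, M₁ k x = 0 ∨ ∫⁻ ω, returnTime Y S x ω ∂(P x) < ⊤

end MarkovCD

end

/-! Finiteness follows once the masses `m x` are bounded below, and this comes from an
entropy-information inequality. Along the heat flow the entropy decreases at rate `I`, the Fisher
information. Since `Υ` is the function that makes the chain rule for `log` work, the derivative of
`I` is `-2 ∑ m u Ψ₂(log u)`. The curvature-dimension condition and Jensen's inequality then give `I'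
≤ -2 (κ I + I^(1+δ)/n)`. Using `I` as the time variable, the entropy of a density is at most the
integral of `1 / (2 (κ + s^δ/n))` for `s` from `0` to `I`. This is bounded in `I` if `δ > 1`, and
grows like `log I` if `δ = 1` (`entropy_le_of_CDUpsilon`).

The inequality is tested on a mixture of the constant density and the point mass at `x₀`
(`exists_peaked_density`). Its entropy is about `½ log (1 / m x₀)`, and its Fisher information is at
most of order `deg r x₀ * log (1 / m x₀)`. For `δ > 1`, and for `δ = 1` with bounded rates, this
bounds `log (1 / m x₀)` uniformly in `x₀`. The converse is immediate, because a function on a finite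
set is bounded.

The rates may be unbounded, so the flow is replaced by implicit Euler steps `u - t L u = g`,
solvable between constant barriers (`exists_resolvent`). Convexity makes the Fisher estimate exact
for each step (`fisher_step`). The entropy estimate has a quadratic error (`entropy_step`), whose
sum is controlled by the decrease of the Dirichlet energy (`energy_step`). -/

namespace MarkovCD

variable {X : Type*}

/-! ### Reversible rates: summability, integration by parts, resolvent. -/

/-- Jump rates `r` (summable rows) with a strictly positive reversible probability density `m`
for which the total jump rate is square integrable. -/
structure IsReversible (m : X → ℝ) (r : X → X → ℝ) : Prop where
  pos : ∀ x, 0 < m x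
  hasSum_one : HasSum m 1
  rate_nonneg : ∀ x y, 0 ≤ r x y
  row : ∀ x, Summable (r x)
  symm : ∀ x y, m x * r x y = m y * r y x
  sq : Summable fun x => m x * (∑' y, r x y) ^ 2

/-- Total rate at `x`. -/
noncomputable def deg (r : X → X → ℝ) (x : X) : ℝ := ∑' y, r x y

namespace IsReversible

variable {m : X → ℝ} {r : X → X → ℝ}

theorem deg_nonneg (h : IsReversible m r) (x : X) : 0 ≤ deg r x :=
  tsum_nonneg (h.rate_nonneg x)

theorem weight_nonneg (h : IsReversible m r) (x y : X) : 0 ≤ m x * r x y :=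
  mul_nonneg (h.pos x).le (h.rate_nonneg x y)

theorem summable_of_bounded (h : IsReversible m r) {a : X → ℝ} {C : ℝ} (ha : ∀ x, |a x| ≤ C) :
    Summable fun x => m x * a x := by
  refine Summable.of_norm_bounded (h.hasSum_one.summable.mul_right C) fun x => ?_
  rw [Real.norm_eq_abs, abs_mul, abs_of_pos (h.pos x)]
  exact mul_le_mul_of_nonneg_left (ha x) (h.pos x).le

theorem summable_one_add_deg_sq (h : IsReversible m r) :
    Summable fun x => m x * (2 * (1 + deg r x ^ 2)) := by
  have := (h.hasSum_one.summable.add h.sq).mul_left 2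
  refine this.congr fun x => ?_
  simp only [deg]; ring

/-- Summing over `y` first leaves `m x (deg + deg²)`, which is where the square integrability of the
total rate enters. -/
theorem summable_weight_deg_left (h : IsReversible m r) :
    Summable fun p : X × X => m p.1 * r p.1 p.2 * (1 + deg r p.1) := by
  have hd : ∀ x, 0 ≤ 1 + deg r x := fun x => add_nonneg zero_le_one (h.deg_nonneg x)
  have hsum : ∀ x, ∑' y, m x * r x y * (1 + deg r x) = m x * (deg r x * (1 + deg r x)) := fun x => by
    rw [tsum_mul_right, tsum_mul_left, mul_assoc]; rfl
  refine (summable_prod_of_nonneg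
    (fun p => mul_nonneg (h.weight_nonneg p.1 p.2) (hd p.1))).2
    ⟨fun x => ((h.row x).mul_left (m x)).mul_right (1 + deg r x), ?_⟩
  have key : Summable fun x => m x * (deg r x * (1 + deg r x)) := by
    refine Summable.of_nonneg_of_le
      (fun x => mul_nonneg (h.pos x).le (mul_nonneg (h.deg_nonneg x) (hd x))) (fun x => ?_)
      h.summable_one_add_deg_sq
    refine mul_le_mul_of_nonneg_left ?_ (h.pos x).le
    nlinarith [sq_nonneg (deg r x - 1), sq_nonneg (deg r x)]
  exact key.congr fun x => (hsum x).symm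

theorem hasSum_swap (h : IsReversible m r) {φ : X → X → ℝ} {s : ℝ}
    (hs : HasSum (fun p : X × X => m p.1 * r p.1 p.2 * φ p.1 p.2) s) :
    HasSum (fun p : X × X => m p.1 * r p.1 p.2 * φ p.2 p.1) s := by
  have := (Equiv.prodComm X X).hasSum_iff.2 hs
  refine this.congr_fun fun p => ?_
  simp [h.symm p.1 p.2]

/-- Reversibility exchanges the two endpoints, so growth in `deg r y` costs no more than growth in
`deg r x`. This admits functions such as `L f`, which are controlled only by the total rate. -/
theorem summable_weight (h : IsReversible m r) {φ : X → X → ℝ} {C : ℝ}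
    (hφ : ∀ x y, |φ x y| ≤ C * (1 + deg r x) + C * (1 + deg r y)) :
    Summable fun p : X × X => m p.1 * r p.1 p.2 * φ p.1 p.2 := by
  have h1 := h.summable_weight_deg_left
  have h2 := (h.hasSum_swap (φ := fun x _ => 1 + deg r x) h1.hasSum).summable
  refine Summable.of_norm_bounded ((h1.mul_left C).add (h2.mul_left C)) fun p => ?_
  rw [Real.norm_eq_abs, abs_mul, abs_of_nonneg (h.weight_nonneg _ _)]
  have := mul_le_mul_of_nonneg_left (hφ p.1 p.2) (h.weight_nonneg p.1 p.2)
  linarith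

theorem summable_row (h : IsReversible m r) {φ : X → X → ℝ}
    (hs : Summable fun p : X × X => m p.1 * r p.1 p.2 * φ p.1 p.2) (x : X) :
    Summable fun y => r x y * φ x y := by
  have := (hs.prod_factor x).mul_left (m x)⁻¹
  refine this.congr fun y => ?_
  have := (h.pos x).ne'
  field_simp

theorem hasSum_rows (h : IsReversible m r) {φ : X → X → ℝ} {s : ℝ}
    (hs : HasSum (fun p : X × X => m p.1 * r p.1 p.2 * φ p.1 p.2) s) :
    HasSum (fun x => m x * ∑' y, r x y * φ x y) s := by
  refine hs.prod_fiberwise fun x => ?_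
  have := ((h.summable_row hs.summable x).hasSum).mul_left (m x)
  simpa only [mul_assoc] using this

theorem abs_generator_le (h : IsReversible m r) {f : X → ℝ} {C : ℝ} (hf : ∀ x, |f x| ≤ C)
    (x : X) : |generator r f x| ≤ 2 * C * deg r x := by
  have hb : ∀ y, ‖r x y * (f y - f x)‖ ≤ 2 * C * r x y := fun y => by
    rw [Real.norm_eq_abs, abs_mul, abs_of_nonneg (h.rate_nonneg x y)]
    have := abs_sub (f y) (f x)
    nlinarith [hf x, hf y, h.rate_nonneg x y]
  have := tsum_of_norm_bounded ((h.row x).hasSum.mul_left (2 * C)) hb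
  exact this

theorem abs_Psi_le (h : IsReversible m r) {H : ℝ → ℝ} {f : X → ℝ} {C : ℝ}
    (hf : ∀ x y, |H (f y - f x)| ≤ C) (x : X) : |Psi r H f x| ≤ C * deg r x := by
  have hb : ∀ y, ‖r x y * H (f y - f x)‖ ≤ C * r x y := fun y => by
    rw [Real.norm_eq_abs, abs_mul, abs_of_nonneg (h.rate_nonneg x y), mul_comm]
    exact mul_le_mul_of_nonneg_right (hf x y) (h.rate_nonneg x y)
  exact tsum_of_norm_bounded ((h.row x).hasSum.mul_left C) hb

/-- Integration by parts for a bounded `a` and a `b` dominated by the total rate. -/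
theorem green (h : IsReversible m r) {a b : X → ℝ} {A C : ℝ} (ha : ∀ x, |a x| ≤ A)
    (hb : ∀ x, |b x| ≤ C * (1 + deg r x)) :
    ∃ G, HasSum (fun x => m x * (a x * generator r b x)) G ∧
      HasSum (fun x => m x * (b x * generator r a x)) G ∧
      HasSum (fun p : X × X => m p.1 * r p.1 p.2 * ((a p.2 - a p.1) * (b p.2 - b p.1))) (-2 * G) ∧
      HasSum (fun x => m x * ∑' y, r x y * ((a y - a x) * (b y - b x))) (-2 * G) := by
  have bound : ∀ x y, |a x * b y| ≤ A * C * (1 + deg r y) := fun x y => by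
    rw [abs_mul, mul_assoc]
    exact mul_le_mul (ha x) (hb y) (abs_nonneg _) ((abs_nonneg _).trans (ha x))
  have hnn : ∀ x, 0 ≤ A * C * (1 + deg r x) := fun x => (abs_nonneg _).trans (bound x x)
  have s1 := h.summable_weight (φ := fun x y => a x * b y) (C := A * C)
    fun x y => (bound x y).trans (by linarith [hnn x])
  have s2 := h.summable_weight (φ := fun x _ => a x * b x) (C := A * C)
    fun x y => (bound x x).trans (by linarith [hnn y])
  obtain ⟨S1, t1⟩ := s1
  obtain ⟨S2, t2⟩ := s2
  have t1' := h.hasSum_swap (φ := fun x y => a x * b y) t1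
  have t2' := h.hasSum_swap (φ := fun x _ => a x * b x) t2
  have u1 : HasSum (fun p : X × X => m p.1 * r p.1 p.2 * (a p.1 * (b p.2 - b p.1))) (S1 - S2) :=
    (t1.sub t2).congr_fun fun p => by ring
  have u2 : HasSum (fun p : X × X => m p.1 * r p.1 p.2 * (b p.1 * (a p.2 - a p.1))) (S1 - S2) :=
    (t1'.sub t2).congr_fun fun p => by ring
  have u3 : HasSum (fun p : X × X => m p.1 * r p.1 p.2 * ((a p.2 - a p.1) * (b p.2 - b p.1)))
      (-2 * (S1 - S2)) := by
    have := (t2'.add t2).sub (t1.add t1')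
    have e : S2 + S2 - (S1 + S1) = -2 * (S1 - S2) := by ring
    rw [e] at this
    exact this.congr_fun fun p => by ring
  refine ⟨S1 - S2, ?_, ?_, u3, h.hasSum_rows (φ := fun x y => (a y - a x) * (b y - b x)) u3⟩
  · refine (h.hasSum_rows (φ := fun x y => a x * (b y - b x)) u1).congr_fun fun x => ?_
    simp only [generator]
    rw [← tsum_mul_left]
    congr 2; ext y; ring
  · refine (h.hasSum_rows (φ := fun x y => b x * (a y - a x)) u2).congr_fun fun x => ?_
    simp only [generator]
    rw [← tsum_mul_left]
    congr 2; ext y; ring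

theorem hasSum_generator (h : IsReversible m r) {a : X → ℝ} {A : ℝ} (ha : ∀ x, |a x| ≤ A) :
    HasSum (fun x => m x * generator r a x) 0 := by
  obtain ⟨G, h1, h2, -, -⟩ := h.green (b := fun _ => 1) (C := 1) ha fun x => by
    simp [h.deg_nonneg x]
  have : G = 0 := h1.unique (by simp [generator])
  subst this
  simpa using h2

/-- Solvability of the resolvent equation between constant barriers. -/
theorem exists_resolvent (h : IsReversible m r) {g : X → ℝ} {c C t : ℝ} (ht : 0 ≤ t) (hcC : c ≤ C)
    (hg : ∀ x, g x ∈ Set.Icc c C) :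
    ∃ u : X → ℝ, (∀ x, u x ∈ Set.Icc c C) ∧ ∀ x, u x - t * generator r u x = g x := by
  have : Fact (c ≤ C) := ⟨hcC⟩
  have hbd : ∀ {u : X → ℝ}, (∀ x, u x ∈ Set.Icc c C) → ∀ x, Summable fun y => r x y * u y :=
    fun {u} hu x => Summable.of_norm_bounded ((h.row x).mul_right (max |c| |C|)) fun y => by
      rw [Real.norm_eq_abs, abs_mul, abs_of_nonneg (h.rate_nonneg x y)]
      refine mul_le_mul_of_nonneg_left ?_ (h.rate_nonneg x y)
      exact abs_le_max_abs_abs (hu y).1 (hu y).2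
  have hden : ∀ x, 0 < 1 + t * deg r x := fun x => by
    have := mul_nonneg ht (h.deg_nonneg x); linarith
  have mono : ∀ {u v : X → ℝ}, (∀ x, u x ∈ Set.Icc c C) → (∀ x, v x ∈ Set.Icc c C) →
      (∀ x, u x ≤ v x) → ∀ x, ∑' y, r x y * u y ≤ ∑' y, r x y * v y := fun hu hv huv x =>
    (hbd hu x).tsum_le_tsum (fun y => mul_le_mul_of_nonneg_left (huv y) (h.rate_nonneg x y))
      (hbd hv x)
  have lo : ∀ {u : X → ℝ}, (∀ x, u x ∈ Set.Icc c C) → ∀ x, deg r x * c ≤ ∑' y, r x y * u y :=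
    fun {u} hu x => by
      have := mono (u := fun _ => c) (fun x => ⟨le_rfl, hcC⟩) hu (fun x => (hu x).1) x
      rwa [tsum_mul_right] at this
  have hi : ∀ {u : X → ℝ}, (∀ x, u x ∈ Set.Icc c C) → ∀ x, ∑' y, r x y * u y ≤ deg r x * C :=
    fun {u} hu x => by
      have := mono (v := fun _ => C) hu (fun x => ⟨hcC, le_rfl⟩) (fun x => (hu x).2) x
      rwa [tsum_mul_right] at this
  -- Solving the equation for the diagonal term turns it into a fixed-point problem for a monotone
  -- map of the complete lattice of functions with values in `[c, C]`. Knaster–Tarski applies with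
  -- no bound on the rates.
  let T : (X → Set.Icc c C) →o (X → Set.Icc c C) :=
    { toFun := fun u x => ⟨(g x + t * ∑' y, r x y * (u y : ℝ)) / (1 + t * deg r x), by
        rw [Set.mem_Icc, le_div_iff₀ (hden x), div_le_iff₀ (hden x)]
        have h1 := mul_le_mul_of_nonneg_left (lo (fun y => (u y).2) x) ht
        have h2 := mul_le_mul_of_nonneg_left (hi (fun y => (u y).2) x) ht
        have := (hg x).1
        have := (hg x).2
        constructor <;> nlinarith⟩
      monotone' := fun u v huv x => by
        rw [← Subtype.coe_le_coe]
        refine div_le_div_of_nonneg_right ?_ (hden x).le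
        have := mono (fun y => (u y).2) (fun y => (v y).2) (fun y => huv y) x
        have := mul_le_mul_of_nonneg_left this ht
        linarith }
  refine ⟨fun x => (T.lfp x : ℝ), fun x => (T.lfp x).2, fun x => ?_⟩
  have hfix : (T.lfp x : ℝ) = (g x + t * ∑' y, r x y * (T.lfp y : ℝ)) / (1 + t * deg r x) := by
    conv_lhs => rw [← T.map_lfp]
    rfl
  have hgen : generator r (fun x => (T.lfp x : ℝ)) x
      = ∑' y, r x y * (T.lfp y : ℝ) - deg r x * (T.lfp x : ℝ) := by
    rw [deg, ← tsum_mul_right, ← (hbd (fun y => (T.lfp y).2) x).tsum_sub ((h.row x).mul_right _)]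
    simp only [generator, mul_sub]
  rw [hgen]
  rw [eq_div_iff (hden x).ne'] at hfix
  linarith

end IsReversible

/-! ### Entropy, Fisher information, energy, and scalar inequalities. -/

/-- The relative entropy `∑ m u log u`. -/
noncomputable def entropy (m u : X → ℝ) : ℝ := ∑' x, m x * (u x * Real.log (u x))

/-- The Fisher information `½ ∑ m(x) r(x,y) (u(y) - u(x)) (log u(y) - log u(x))`. -/
noncomputable def fisher (m : X → ℝ) (r : X → X → ℝ) (u : X → ℝ) : ℝ :=
  (1 / 2) * ∑' p : X × X,
    m p.1 * r p.1 p.2 * ((u p.2 - u p.1) * (Real.log (u p.2) - Real.log (u p.1)))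

/-- The Dirichlet energy `½ ∑ m(x) r(x,y) (u(y) - u(x))²`. -/
noncomputable def energy (m : X → ℝ) (r : X → X → ℝ) (u : X → ℝ) : ℝ :=
  (1 / 2) * ∑' p : X × X, m p.1 * r p.1 p.2 * ((u p.2 - u p.1) * (u p.2 - u p.1))

theorem deriv_Upsilon (s : ℝ) : deriv Upsilon s = Real.exp s - 1 := by
  have : HasDerivAt Upsilon (Real.exp s - 1) s := by
    exact ((Real.hasDerivAt_exp s).sub (hasDerivAt_id s)).sub_const 1
  exact this.deriv

theorem Upsilon_nonneg (s : ℝ) : 0 ≤ Upsilon s := by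
  have := Real.add_one_le_exp s
  simp only [Upsilon]; linarith

theorem Upsilon_log_sub {a b : ℝ} (ha : 0 < a) (hb : 0 < b) :
    Upsilon (Real.log b - Real.log a) = b / a - (Real.log b - Real.log a) - 1 := by
  rw [Upsilon, Real.exp_sub, Real.exp_log ha, Real.exp_log hb]

/-- First-order convexity of the logarithmic mean form `(b - a)(log b - log a)`. -/
theorem log_form_convex {a b a' b' : ℝ} (ha : 0 < a) (hb : 0 < b) (ha' : 0 < a') (hb' : 0 < b') :
    (b - a) * (Real.log b - Real.log a)
      + ((Real.log a - Real.log b) - (b - a) / a) * (a' - a)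
      + ((Real.log b - Real.log a) - (a - b) / b) * (b' - b)
      ≤ (b' - a') * (Real.log b' - Real.log a') := by
  set t := (Real.log b' - Real.log a') - (Real.log b - Real.log a) with ht
  have e1 : Real.exp t = b' * a / (a' * b) := by
    rw [ht, Real.exp_sub, Real.exp_sub, Real.exp_sub, Real.exp_log ha, Real.exp_log hb,
      Real.exp_log ha', Real.exp_log hb']
    field_simp
  have e2 : Real.exp (-t) = a' * b / (b' * a) := by
    rw [Real.exp_neg, e1, inv_div]
  -- The claim is the sum of `1 + t ≤ exp t` weighted by `a'` and `1 - t ≤ exp (-t)` weighted by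
  -- `b'`.
  have h1 := mul_le_mul_of_nonneg_left (Real.add_one_le_exp t) ha'.le
  have h2 := mul_le_mul_of_nonneg_left (Real.add_one_le_exp (-t)) hb'.le
  have e3 : a' * Real.exp t = b' * (a / b) := by rw [e1]; field_simp
  have e4 : b' * Real.exp (-t) = a' * (b / a) := by rw [e2]; field_simp
  rw [e3] at h1
  rw [e4] at h2
  have e5 : (b - a) / a = b / a - 1 := by field_simp
  have e6 : (a - b) / b = a / b - 1 := by field_simp
  have e7 : b / a * a = b := by field_simp
  have e8 : a / b * b = a := by field_simp
  rw [e5, e6]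
  have : Real.log b' - Real.log a' = t + (Real.log b - Real.log a) := by rw [ht]; ring
  rw [this]
  nlinarith

theorem log_form_nonneg {a b : ℝ} (ha : 0 < a) (hb : 0 < b) :
    0 ≤ (b - a) * (Real.log b - Real.log a) := by
  rcases le_total a b with h | h
  · exact mul_nonneg (sub_nonneg.2 h) (sub_nonneg.2 (Real.log_le_log ha h))
  · exact mul_nonneg_of_nonpos_of_nonpos (sub_nonpos.2 h) (sub_nonpos.2 (Real.log_le_log hb h))

/-- `(b - a)² ≤ C (b - a)(log b - log a)` for `a, b ≤ C`. -/
theorem sq_le_log_form {a b C : ℝ} (ha : 0 < a) (hb : 0 < b) (haC : a ≤ C) (hbC : b ≤ C) :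
    (b - a) * (b - a) ≤ C * ((b - a) * (Real.log b - Real.log a)) := by
  have key : ∀ {x y : ℝ}, 0 < x → x ≤ y → y ≤ C → y - x ≤ C * (Real.log y - Real.log x) := by
    intro x y hx hxy hyC
    have hy := hx.trans_le hxy
    have h1 := Real.log_le_sub_one_of_pos (div_pos hx hy)
    rw [Real.log_div hx.ne' hy.ne'] at h1
    have h2 : (y - x) / y ≤ Real.log y - Real.log x := by
      have : (y - x) / y = 1 - x / y := by field_simp
      linarith
    rw [div_le_iff₀ hy] at h2
    have h3 : 0 ≤ Real.log y - Real.log x := sub_nonneg.2 (Real.log_le_log hx hxy)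
    nlinarith
  rcases le_total a b with h | h
  · nlinarith [key ha h hbC]
  · nlinarith [key hb h haC]

/-- Lipschitz bound for the logarithm on `[c, ∞)`. -/
theorem log_sub_mul_sub_le {a b c : ℝ} (hc : 0 < c) (ha : c ≤ a) (hb : c ≤ b) :
    (Real.log b - Real.log a) * (b - a) ≤ c⁻¹ * ((b - a) * (b - a)) := by
  have key : ∀ {x y : ℝ}, c ≤ x → x ≤ y → Real.log y - Real.log x ≤ c⁻¹ * (y - x) := by
    intro x y hx hxy
    have hx0 := hc.trans_le hx
    have hy := hx0.trans_le hxy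
    have h1 := Real.log_le_sub_one_of_pos (div_pos hy hx0)
    rw [Real.log_div hy.ne' hx0.ne'] at h1
    have h2 : y / x - 1 = x⁻¹ * (y - x) := by field_simp
    have h3 : x⁻¹ ≤ c⁻¹ := inv_anti₀ hc hx
    have := mul_le_mul_of_nonneg_right h3 (sub_nonneg.2 hxy)
    linarith
  rcases le_total a b with h | h
  · nlinarith [key ha h]
  · nlinarith [key hb h]

theorem abs_le_of_mem_Icc {u c C : ℝ} (hc : 0 < c) (hu : u ∈ Set.Icc c C) : |u| ≤ C := by
  rw [abs_of_pos (hc.trans_le hu.1)]; exact hu.2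

theorem abs_log_le_of_mem_Icc {u c C : ℝ} (hc : 0 < c) (hu : u ∈ Set.Icc c C) :
    |Real.log u| ≤ max |Real.log c| |Real.log C| :=
  abs_le_max_abs_abs (Real.log_le_log hc hu.1) (Real.log_le_log (hc.trans_le hu.1) hu.2)

/-! ### One implicit Euler step: Fisher information, entropy, energy. -/

namespace IsReversible

variable {m : X → ℝ} {r : X → X → ℝ} {u g : X → ℝ} {c C t : ℝ}

theorem bound_one_add_deg (h : IsReversible m r) {b : X → ℝ} {K : ℝ} (hb : ∀ x, |b x| ≤ K)
    (x : X) : |b x| ≤ K * (1 + deg r x) := by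
  have := h.deg_nonneg x
  have := (abs_nonneg _).trans (hb x)
  nlinarith [hb x]

theorem bound_deg {b : X → ℝ} {K : ℝ} (hK : 0 ≤ K)
    (hb : ∀ x, |b x| ≤ K * deg r x) (x : X) : |b x| ≤ K * (1 + deg r x) := by
  nlinarith [hb x]

theorem fisher_eq (h : IsReversible m r) (hc : 0 < c) (hu : ∀ x, u x ∈ Set.Icc c C) :
    HasSum (fun x => m x * (u x * generator r (fun y => Real.log (u y)) x)) (-fisher m r u) ∧
      HasSum (fun x => m x * (Real.log (u x) * generator r u x)) (-fisher m r u) ∧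
      HasSum (fun p : X × X => m p.1 * r p.1 p.2 *
        ((u p.2 - u p.1) * (Real.log (u p.2) - Real.log (u p.1)))) (2 * fisher m r u) := by
  obtain ⟨G, h1, h2, h3, -⟩ := h.green (fun x => abs_le_of_mem_Icc hc (hu x))
    (h.bound_one_add_deg fun x => abs_log_le_of_mem_Icc hc (hu x))
  have e : G = -fisher m r u := by
    rw [fisher, h3.tsum_eq]; ring
  subst e
  exact ⟨h1, h2, by convert h3 using 1; ring⟩

theorem fisher_nonneg (h : IsReversible m r) (hc : 0 < c) (hu : ∀ x, u x ∈ Set.Icc c C) :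
    0 ≤ fisher m r u := by
  refine mul_nonneg (by norm_num) (tsum_nonneg fun p => mul_nonneg (h.weight_nonneg _ _) ?_)
  exact log_form_nonneg (hc.trans_le (hu p.1).1) (hc.trans_le (hu p.2).1)

theorem summable_generator (h : IsReversible m r) {b : X → ℝ} {K : ℝ} (hb : ∀ x, |b x| ≤ K)
    (x : X) : Summable fun y => r x y * (b y - b x) :=
  Summable.of_norm_bounded ((h.row x).mul_left (2 * K)) fun y => by
    rw [Real.norm_eq_abs, abs_mul, abs_of_nonneg (h.rate_nonneg x y)]
    have := abs_sub (b y) (b x)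
    nlinarith [hb x, hb y, h.rate_nonneg x y]

/-- The defect in the chain rule for `log` is exactly `Υ` of the increment of `log u`. Multiplied by
`u` and integrated, it gives the Fisher information. -/
theorem Psi_Upsilon_log (h : IsReversible m r) (hc : 0 < c) (hu : ∀ x, u x ∈ Set.Icc c C) (x : X) :
    Psi r Upsilon (fun y => Real.log (u y)) x
      = generator r u x / u x - generator r (fun y => Real.log (u y)) x := by
  have s1 := h.summable_generator (fun x => abs_le_of_mem_Icc hc (hu x)) x
  have s2 := h.summable_generator (fun x => abs_log_le_of_mem_Icc hc (hu x)) x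
  have hpos : ∀ y, 0 < u y := fun y => hc.trans_le (hu y).1
  simp only [Psi, generator]
  rw [← tsum_div_const, ← (s1.div_const _).tsum_sub s2]
  congr 1; ext y
  rw [Upsilon_log_sub (hpos x) (hpos y)]
  have := (hpos x).ne'
  field_simp
  ring

/-- The dissipation of the Fisher information along the semigroup. -/
theorem dissipation (h : IsReversible m r) (hc : 0 < c) (hu : ∀ x, u x ∈ Set.Icc c C) :
    ∃ D, HasSum (fun x => m x * (u x * Psi₂ r Upsilon (fun y => Real.log (u y)) x)) (D / 2) ∧
      HasSum (fun x => m x * (generator r u x * (generator r u x / u x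
        + generator r (fun y => Real.log (u y)) x))) D := by
  set f : X → ℝ := fun y => Real.log (u y) with hf
  set K := max |Real.log c| |Real.log C| with hK
  have hpos : ∀ y, 0 < u y := fun y => hc.trans_le (hu y).1
  have hfK : ∀ x, |f x| ≤ K := fun x => abs_log_le_of_mem_Icc hc (hu x)
  have hK0 : 0 ≤ K := (abs_nonneg _).trans (le_max_left _ _)
  have hΨ : ∀ x, |Psi r Upsilon f x| ≤ (Real.exp (2 * K) + 2 * K) * deg r x :=
    h.abs_Psi_le fun x y => by
      have h1 := abs_le.1 (hfK x)
      have h2 := abs_le.1 (hfK y)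
      rw [abs_of_nonneg (Upsilon_nonneg _), Upsilon]
      have : Real.exp (f y - f x) ≤ Real.exp (2 * K) := Real.exp_le_exp.2 (by linarith)
      linarith
  obtain ⟨G₁, a1, a2, -, -⟩ := h.green (fun x => abs_le_of_mem_Icc hc (hu x))
    (bound_deg (r := r) (by positivity) hΨ)
  obtain ⟨G₂, -, b2, -, b4⟩ := h.green (fun x => abs_le_of_mem_Icc hc (hu x))
    (bound_deg (r := r) (by positivity) (h.abs_generator_le hfK))
  -- With `f = log u`, the factor `exp (f y - f x) - 1` times `u x` is the increment of `u`. The `B`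
  -- term thus becomes a bilinear form in `u` and `L f`, ready for integration by parts.
  have hB : ∀ x, u x * B r (deriv Upsilon) f (generator r f) x
      = ∑' y, r x y * ((u y - u x) * (generator r f y - generator r f x)) := fun x => by
    rw [B, ← tsum_mul_left]
    congr 1; ext y
    have e : u x * (Real.exp (f y - f x) - 1) = u y - u x := by
      rw [hf, Real.exp_sub, Real.exp_log (hpos y), Real.exp_log (hpos x)]
      have := (hpos x).ne'
      field_simp
    rw [deriv_Upsilon, ← e]; ring
  refine ⟨G₁ + 2 * G₂, ?_, ?_⟩
  · have e : (G₁ + 2 * G₂) / 2 = 1 / 2 * (G₁ - -2 * G₂) := by ring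
    rw [e]
    refine ((a1.sub b4).mul_left (1 / 2)).congr_fun fun x => ?_
    rw [← hB x, Psi₂]; ring
  · refine (a2.add (b2.mul_left 2)).congr_fun fun x => ?_
    rw [h.Psi_Upsilon_log hc hu x]; ring

/-- One implicit Euler step decreases the Fisher information at least by the dissipation. -/
theorem fisher_step (h : IsReversible m r) (hc : 0 < c) (hu : ∀ x, u x ∈ Set.Icc c C)
    (hg : ∀ x, g x ∈ Set.Icc c C) (he : ∀ x, u x - t * generator r u x = g x) :
    fisher m r u + t * (2 * ∑' x, m x * (u x * Psi₂ r Upsilon (fun y => Real.log (u y)) x))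
      ≤ fisher m r g := by
  obtain ⟨D, d1, d2⟩ := h.dissipation hc hu
  rw [d1.tsum_eq]
  have hpos : ∀ y, 0 < u y := fun y => hc.trans_le (hu y).1
  have hgpos : ∀ y, 0 < g y := fun y => hc.trans_le (hg y).1
  set K := max |Real.log c| |Real.log C| with hK
  have hK0 : 0 ≤ K := (abs_nonneg _).trans (le_max_left _ _)
  have hlog : ∀ x, |Real.log (u x)| ≤ K := fun x => abs_log_le_of_mem_Icc hc (hu x)
  -- This is the first of the two linear terms in `log_form_convex` at `(u x, u y)`; the second is
  -- `φ y x`. As `g - u = -t L u`, each of them integrates to `t * D`.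
  let φ : X → X → ℝ := fun x y =>
    ((Real.log (u x) - Real.log (u y)) - (u y - u x) / u x) * (g x - u x)
  have hφ : ∀ x y, |φ x y| ≤ (2 * K + 2 * C / c) * (2 * C) := fun x y => by
    have hx := hu x; have hy := hu y; have hgx := hg x
    have hC0 : 0 ≤ C := hc.le.trans (hx.1.trans hx.2)
    rw [abs_mul]
    refine mul_le_mul ?_ ?_ (abs_nonneg _) (by positivity)
    · refine (abs_sub _ _).trans (add_le_add ((abs_sub _ _).trans ?_) ?_)
      · linarith [hlog x, hlog y]
      · rw [abs_div, abs_of_pos (hpos x)]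
        refine div_le_div₀ (by positivity) ?_ hc hx.1
        rw [abs_le]; constructor <;> linarith [hx.1, hx.2, hy.1, hy.2]
    · rw [abs_le]; constructor <;> linarith [hx.1, hx.2, hgx.1, hgx.2]
  obtain ⟨s, hs⟩ := h.summable_weight (φ := φ) (C := (2 * K + 2 * C / c) * (2 * C)) fun x y => by
    have := hφ x y
    have h0 := (abs_nonneg _).trans this
    nlinarith [h.deg_nonneg x, h.deg_nonneg y]
  have hrow := h.hasSum_rows hs
  have hsD : s = t * D := by
    refine hrow.unique ((d2.mul_left t).congr_fun fun x => ?_)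
    have e : ∀ y, r x y * φ x y = -(g x - u x) * (r x y * (u y - u x) / u x
        + r x y * (Real.log (u y) - Real.log (u x))) := fun y => by
      simp only [φ]; ring
    have s1 := h.summable_generator (fun x => abs_le_of_mem_Icc hc (hu x)) x
    have s2 := h.summable_generator hlog x
    simp only [e]
    rw [tsum_mul_left, (s1.div_const _).tsum_add s2, tsum_div_const, ← he x]
    simp only [generator]
    ring
  have swap := h.hasSum_swap hs
  have hF := (h.fisher_eq hc hu).2.2
  have := hasSum_le (fun p => ?_) ((hF.add hs).add swap) (h.fisher_eq hc hg).2.2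
  · linarith
  · rw [← mul_add, ← mul_add]
    refine mul_le_mul_of_nonneg_left ?_ (h.weight_nonneg _ _)
    exact log_form_convex (hpos p.1) (hpos p.2) (hgpos p.1) (hgpos p.2)

/-- The tangent at `a` lies below the convex power for `b ≥ 0` and is nonpositive for `b < 0`, so
the extension by zero still dominates it. It serves as the supporting line in Jensen's inequality.
-/
theorem rpow_tangent {p a b : ℝ} (hp : 1 ≤ p) (ha : 0 ≤ a) :
    a ^ p + p * a ^ (p - 1) * (b - a) ≤ trivialExtension (fun s => s ^ p) b := by
  have hmul : a ^ p = a ^ (p - 1) * a := by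
    rcases ha.eq_or_lt with rfl | ha
    · simp [Real.zero_rpow (by linarith : p ≠ 0)]
    · rw [← Real.rpow_add_one ha.ne']; ring_nf
  have hA : 0 ≤ a ^ (p - 1) := Real.rpow_nonneg ha _
  rw [trivialExtension]
  split_ifs with hb
  · rcases ha.eq_or_lt with rfl | ha
    · rcases hp.eq_or_lt with rfl | hp'
      · simp
      · rw [Real.zero_rpow (by linarith : p ≠ 0), Real.zero_rpow (by linarith : p - 1 ≠ 0)]
        simpa using Real.rpow_nonneg hb p
    · have h1 := one_add_mul_self_le_rpow_one_add (s := b / a - 1)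
        (by have := div_nonneg hb ha.le; linarith) hp
      rw [add_sub_cancel, Real.div_rpow hb ha.le, le_div_iff₀ (Real.rpow_pos_of_pos ha p)] at h1
      refine le_trans (le_of_eq ?_) h1
      rw [hmul]
      field_simp
  · push Not at hb
    rw [hmul]
    nlinarith [mul_nonneg hA ha, mul_nonneg hA (neg_nonneg.2 hb.le)]

/-- Integrated form of the curvature-dimension condition along one implicit Euler step. -/
theorem fisher_step_of_CDUpsilon (h : IsReversible m r) (hc : 0 < c) (ht : 0 ≤ t)
    (hu : ∀ x, u x ∈ Set.Icc c C) (hg : ∀ x, g x ∈ Set.Icc c C)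
    (he : ∀ x, u x - t * generator r u x = g x) (h1 : HasSum (fun x => m x * u x) 1)
    {κ δ n : ℝ} (hδ : 0 ≤ δ) (hn : 0 < n) (hCD : CDUpsilon r κ fun s => s ^ (1 + δ) / n) :
    fisher m r u + 2 * t * (κ * fisher m r u + fisher m r u ^ (1 + δ) / n) ≤ fisher m r g := by
  refine le_trans ?_ (h.fisher_step hc hu hg he)
  obtain ⟨D, d1, -⟩ := h.dissipation hc hu
  obtain ⟨f1, -, -⟩ := h.fisher_eq hc hu
  set J := fisher m r u with hJ
  have hJ0 : 0 ≤ J := h.fisher_nonneg hc hu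
  set f : X → ℝ := fun y => Real.log (u y) with hf
  have hpos : ∀ y, 0 < u y := fun y => hc.trans_le (hu y).1
  have hLu := h.hasSum_generator fun x => abs_le_of_mem_Icc hc (hu x)
  have hΨ : HasSum (fun x => m x * (u x * Psi r Upsilon f x)) J := by
    have := hLu.sub f1
    rw [zero_sub, neg_neg] at this
    refine this.congr_fun fun x => ?_
    rw [h.Psi_Upsilon_log hc hu x, ← hf]
    have := (hpos x).ne'
    field_simp
  -- Jensen's inequality for the probability weights `m u`: the mean of `-L (log u)` is `J`, so the
  -- tangent taken at `J` integrates to `J ^ (1 + δ)`.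
  have key := (hΨ.mul_left κ).add ((h1.mul_left ((J ^ (1 + δ) - (1 + δ) * J ^ δ * J) / n)).add
    (f1.mul_left (-((1 + δ) * J ^ δ) / n)))
  have hle := hasSum_le (fun x => ?_) key d1
  · rw [d1.tsum_eq]
    have e : κ * J + ((J ^ (1 + δ) - (1 + δ) * J ^ δ * J) / n * 1
        + -((1 + δ) * J ^ δ) / n * -J) = κ * J + J ^ (1 + δ) / n := by ring
    rw [e] at hle
    nlinarith
  · have hcd := hCD f ⟨_, fun y => abs_log_le_of_mem_Icc hc (hu y)⟩ x
    have htan := rpow_tangent (p := 1 + δ) (b := -generator r f x) (by linarith) hJ0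
    have hte : trivialExtension (fun s => s ^ (1 + δ) / n) (-generator r f x)
        = trivialExtension (fun s => s ^ (1 + δ)) (-generator r f x) / n := by
      simp only [trivialExtension]; split_ifs <;> simp
    rw [hte] at hcd
    rw [add_sub_cancel_left] at htan
    have htan' := div_le_div_of_nonneg_right htan hn.le
    have hfin := mul_le_mul_of_nonneg_left ((add_le_add_right htan' _).trans hcd)
      (mul_nonneg (h.pos x).le (hpos x).le)
    refine le_trans (le_of_eq ?_) (hfin.trans (le_of_eq ?_)) <;> ring

theorem summable_sq_sub (h : IsReversible m r) (hc : 0 < c) (hu : ∀ x, u x ∈ Set.Icc c C)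
    (hg : ∀ x, g x ∈ Set.Icc c C) : Summable fun x => m x * ((g x - u x) * (g x - u x)) :=
  h.summable_of_bounded (C := 2 * C * (2 * C)) fun x => by
    have := (abs_sub (g x) (u x)).trans
      (add_le_add (abs_le_of_mem_Icc hc (hg x)) (abs_le_of_mem_Icc hc (hu x)))
    rw [abs_mul]
    exact mul_le_mul (by linarith) (by linarith) (abs_nonneg _)
      (by linarith [abs_nonneg (g x - u x)])

theorem summable_entropy (h : IsReversible m r) (hc : 0 < c) (hu : ∀ x, u x ∈ Set.Icc c C) :
    Summable fun x => m x * (u x * Real.log (u x)) :=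
  h.summable_of_bounded (C := C * max |Real.log c| |Real.log C|) fun x => by
    rw [abs_mul]
    exact mul_le_mul (abs_le_of_mem_Icc hc (hu x)) (abs_log_le_of_mem_Icc hc (hu x))
      (abs_nonneg _) ((abs_nonneg _).trans (abs_le_of_mem_Icc hc (hu x)))

/-- The entropy drop in one implicit Euler step. -/
theorem entropy_step (h : IsReversible m r) (hc : 0 < c)
    (hu : ∀ x, u x ∈ Set.Icc c C) (hg : ∀ x, g x ∈ Set.Icc c C)
    (he : ∀ x, u x - t * generator r u x = g x) :
    entropy m g ≤ entropy m u + t * fisher m r u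
      + c⁻¹ * ∑' x, m x * ((g x - u x) * (g x - u x)) := by
  have hLu := h.hasSum_generator fun x => abs_le_of_mem_Icc hc (hu x)
  have key := ((h.summable_entropy hc hu).hasSum.add
    (((h.fisher_eq hc hu).2.1.add hLu).mul_left (-t))).add
    ((h.summable_sq_sub hc hu hg).hasSum.mul_left c⁻¹)
  have hle := hasSum_le (fun x => ?_) (h.summable_entropy hc hg).hasSum key
  · simp only [entropy] at hle ⊢
    linarith
  · have hux := hc.trans_le (hu x).1
    have hgx := hc.trans_le (hg x).1
    have h1 := Real.log_le_sub_one_of_pos (div_pos hgx hux)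
    rw [Real.log_div hgx.ne' hux.ne'] at h1
    have h2 := mul_le_mul_of_nonneg_left h1 hux.le
    have h2' : u x * (g x / u x - 1) = g x - u x := by field_simp
    rw [h2'] at h2
    have h3 := log_sub_mul_sub_le hc (hu x).1 (hg x).1
    have h4 : generator r u x * t = u x - g x := by linarith [he x]
    -- Replacing `log g` by `log u` in the factor of `g - u` costs the quadratic error; this is the
    -- price of discrete time.
    have h5 : g x * Real.log (g x) ≤ u x * Real.log (u x)
        + -(generator r u x * t) * (Real.log (u x) + 1)
        + c⁻¹ * ((g x - u x) * (g x - u x)) := by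
      rw [h4]; nlinarith
    have h6 := mul_le_mul_of_nonneg_left h5 (h.pos x).le
    linarith

/-- The energy drop in one implicit Euler step. -/
theorem energy_step (h : IsReversible m r) (hc : 0 < c) (ht : 0 < t)
    (hu : ∀ x, u x ∈ Set.Icc c C) (hg : ∀ x, g x ∈ Set.Icc c C)
    (he : ∀ x, u x - t * generator r u x = g x) :
    energy m r u + 2 / t * ∑' x, m x * ((g x - u x) * (g x - u x)) ≤ energy m r g := by
  have hb : ∀ {v : X → ℝ}, (∀ x, v x ∈ Set.Icc c C) → ∀ x, |v x| ≤ C :=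
    fun hv x => abs_le_of_mem_Icc hc (hv x)
  obtain ⟨G₁, -, -, e1, -⟩ := h.green (hb hu) (h.bound_one_add_deg (hb hu))
  obtain ⟨G₂, -, -, e2, -⟩ := h.green (hb hg) (h.bound_one_add_deg (hb hg))
  obtain ⟨G, a1, -, a3, -⟩ := h.green (a := fun x => g x - u x) (A := C + C)
    (fun x => (abs_sub _ _).trans (add_le_add (hb hg x) (hb hu x)))
    (h.bound_one_add_deg (hb hu))
  have hG : ∑' x, m x * ((g x - u x) * (g x - u x)) = -t * G := by
    refine HasSum.tsum_eq ((a1.mul_left (-t)).congr_fun fun x => ?_)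
    rw [← he x]; ring
  -- Expand the energy of `g = u + (g - u)` and drop the energy of `g - u`. The cross term is the
  -- sum of squares computed in `hG`.
  have hle := hasSum_le (fun p => ?_) (e1.add (a3.mul_left 2)) e2
  · rw [hG, energy, energy, e1.tsum_eq, e2.tsum_eq]
    have : 2 / t * (-t * G) = -2 * G := by field_simp
    rw [this]; linarith
  · have := mul_nonneg (h.weight_nonneg p.1 p.2)
      (sq_nonneg ((g p.2 - u p.2) - (g p.1 - u p.1)))
    nlinarith

end IsReversible

/-! ### Iterating the steps: the entropy-information inequality. -/

open Filter Topology

/-- Comparison of one step of the discrete differential inequality with a function `Φ` whose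
derivative dominates `(1 + s)^(-δ)`. -/
theorem step_le_sub {Φ : ℝ → ℝ} {κ δ n t I J : ℝ}
    (hΦ : ∀ a b, 0 ≤ a → a ≤ b → (b - a) / (1 + b) ^ δ ≤ Φ b - Φ a)
    (hκ : 0 < κ) (hδ : 0 ≤ δ) (hn : 0 < n) (ht : 0 ≤ t) (hJ : 0 ≤ J)
    (hsmall : 2 * t * (κ + J ^ δ / n) ≤ 1) (hstep : J + 2 * t * (J * (κ + J ^ δ / n)) ≤ I) :
    t * J ≤ 4 ^ δ * (1 / κ + n) / 2 * (Φ I - Φ J) := by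
  have hJδ : 0 ≤ J ^ δ := Real.rpow_nonneg hJ δ
  set w := κ + J ^ δ / n with hw
  have hw0 : 0 < w := by positivity
  -- `I` may be much larger than `J`, so the increment of `Φ` is estimated only up to `J' ≤ 2 * J`;
  -- from `J'` to `I` monotonicity of `Φ` suffices.
  set J' := J + 2 * t * (J * w) with hJ'
  have hinc : 0 ≤ 2 * t * (J * w) := by positivity
  have hJJ' : J ≤ J' := by linarith
  have h2J : J' ≤ 2 * J := by nlinarith
  have h1 := hΦ J J' hJ hJJ'
  have h2 := hΦ J' I (hJ.trans hJJ') hstep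
  have h3 : 0 ≤ (I - J') / (1 + I) ^ δ :=
    div_nonneg (by linarith) (Real.rpow_nonneg (by linarith) _)
  -- The constant comes from `1 + J' ≤ 4 * max 1 J` and from `(1 / κ + n) * w ≥ 1 + J ^ δ`.
  have hpow : (1 + J') ^ δ ≤ 4 ^ δ * ((1 / κ + n) * w) := by
    have hmax : (1 + J') ^ δ ≤ (4 * max 1 J) ^ δ := by
      refine Real.rpow_le_rpow (by linarith) ?_ hδ
      have := le_max_left 1 J; have := le_max_right 1 J
      linarith
    rw [Real.mul_rpow (by norm_num) (by positivity)] at hmax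
    refine hmax.trans (mul_le_mul_of_nonneg_left ?_ (by positivity))
    have : (1 / κ + n) * w = 1 + J ^ δ + (J ^ δ / (κ * n) + n * κ) := by
      rw [hw]; field_simp; ring
    have h0 : 0 ≤ J ^ δ / (κ * n) + n * κ := by positivity
    rcases max_cases (1 : ℝ) J with ⟨e, -⟩ | ⟨e, -⟩ <;> rw [e, this]
    · rw [Real.one_rpow]; linarith
    · linarith
  have hpos : 0 < (1 + J') ^ δ := Real.rpow_pos_of_pos (by linarith) _
  have h4 : J' - J ≤ (Φ I - Φ J) * (1 + J') ^ δ := by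
    rw [← div_le_iff₀ hpos]; linarith
  have hΦ0 : 0 ≤ Φ I - Φ J := by
    have : 0 ≤ (J' - J) / (1 + J') ^ δ := div_nonneg (by linarith) hpos.le
    linarith
  have h5 := h4.trans (mul_le_mul_of_nonneg_left hpow hΦ0)
  have h6 : J' - J = 2 * (t * J) * w := by rw [hJ']; ring
  rw [h6, ← mul_assoc, ← mul_assoc] at h5
  have := le_of_mul_le_mul_right (h5.trans_eq (mul_assoc _ _ _).symm) hw0
  linarith

namespace IsReversible

variable {m : X → ℝ} {r : X → X → ℝ} {u g : X → ℝ} {c C t : ℝ}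

theorem energy_nonneg (h : IsReversible m r) (u : X → ℝ) : 0 ≤ energy m r u :=
  mul_nonneg (by norm_num) (tsum_nonneg fun p => mul_nonneg (h.weight_nonneg _ _)
    (mul_self_nonneg _))

theorem exists_iterates (h : IsReversible m r) (ht : 0 ≤ t) (hcC : c ≤ C)
    (hu : ∀ x, u x ∈ Set.Icc c C) :
    ∃ U : ℕ → X → ℝ, U 0 = u ∧ (∀ k x, U k x ∈ Set.Icc c C) ∧
      ∀ k x, U (k + 1) x - t * generator r (U (k + 1)) x = U k x := by
  choose R hR1 hR2 using fun g : {g : X → ℝ // ∀ x, g x ∈ Set.Icc c C} =>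
    h.exists_resolvent ht hcC g.2
  let V : ℕ → {g : X → ℝ // ∀ x, g x ∈ Set.Icc c C} := fun k =>
    Nat.rec ⟨u, hu⟩ (fun _ v => ⟨R v, hR1 v⟩) k
  exact ⟨fun k => (V k).1, rfl, fun k => (V k).2, fun k x => hR2 (V k) x⟩

/-- Bound `log u` by its tangent at `u x₀`. The terms independent of the variance add up to `log (u
x₀) + 1 - u x₀ ≤ 0`. Centring at a point value rather than at the mean suits the edge-by-edge
convergence below. -/
theorem entropy_le_variance (h : IsReversible m r) (hc : 0 < c) (hu : ∀ x, u x ∈ Set.Icc c C)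
    (h1 : HasSum (fun x => m x * u x) 1) (x₀ : X) :
    entropy m u ≤ ∑' x, m x * ((u x - u x₀) * (u x - u x₀)) / c := by
  have hs := (h.summable_sq_sub (u := fun _ => u x₀) hc (fun _ => hu x₀) hu).div_const c
  have hpos : ∀ y, 0 < u y := fun y => hc.trans_le (hu y).1
  have key := ((h1.mul_left (Real.log (u x₀))).add (h1.sub (h.hasSum_one.mul_right (u x₀)))).add
    hs.hasSum
  have hle := hasSum_le (fun x => ?_) (h.summable_entropy hc hu).hasSum key
  · have := Real.log_le_sub_one_of_pos (hpos x₀)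
    rw [entropy]
    linarith
  · have h2 := Real.log_le_sub_one_of_pos (div_pos (hpos x) (hpos x₀))
    rw [Real.log_div (hpos x).ne' (hpos x₀).ne'] at h2
    have h3 := mul_le_mul_of_nonneg_left h2 (hpos x).le
    have h4 : u x * (u x / u x₀ - 1) = (u x - u x₀) + (u x - u x₀) * (u x - u x₀) / u x₀ := by
      have := (hpos x₀).ne'
      field_simp; ring
    have h5 := div_le_div_of_nonneg_left (mul_self_nonneg (u x - u x₀)) hc (hu x₀).1
    have h6 := mul_le_mul_of_nonneg_left (h3.trans (h4.le.trans (add_le_add_right h5 _)))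
      (h.pos x).le
    rw [mul_div_assoc]
    linarith

/-- Vanishing Fisher information forces convergence to equilibrium of the entropy. -/
theorem exists_entropy_bound_tendsto (h : IsReversible m r) (hirr : Irreducible r) (hc : 0 < c)
    {U : ℕ → X → ℝ} (hU : ∀ k x, U k x ∈ Set.Icc c C) (h1 : ∀ k, HasSum (fun x => m x * U k x) 1)
    (hI : Tendsto (fun k => fisher m r (U k)) atTop (𝓝 0)) (x₀ : X) :
    ∃ b : ℕ → ℝ, Tendsto b atTop (𝓝 0) ∧ ∀ k, entropy m (U k) ≤ b k := by
  have hpos : ∀ k y, 0 < U k y := fun k y => hc.trans_le (hU k y).1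
  have hC : 0 < C := (hpos 0 x₀).trans_le (hU 0 x₀).2
  -- The Fisher series has nonnegative terms, so a single edge is bounded by the whole; differences
  -- vanish across every edge, hence along every path.
  have edge : ∀ x y, 0 < r x y → Tendsto (fun k => U k y - U k x) atTop (𝓝 0) := by
    intro x y hxy
    have hq : 0 < m x * r x y := mul_pos (h.pos x) hxy
    have hb : ∀ k, (U k y - U k x) ^ 2 ≤ C * (2 * fisher m r (U k) / (m x * r x y)) := fun k => by
      have h2 := (h.fisher_eq hc (hU k)).2.2
      have h3 := le_hasSum h2 (x, y) fun p _ => mul_nonneg (h.weight_nonneg _ _)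
        (log_form_nonneg (hpos k p.1) (hpos k p.2))
      have h4 := sq_le_log_form (hpos k x) (hpos k y) (hU k x).2 (hU k y).2
      rw [pow_two]
      refine h4.trans (mul_le_mul_of_nonneg_left ?_ hC.le)
      rw [le_div_iff₀ hq, mul_comm]
      exact h3
    have hlim : Tendsto (fun k => C * (2 * fisher m r (U k) / (m x * r x y))) atTop (𝓝 0) := by
      have := ((hI.const_mul 2).div_const (m x * r x y)).const_mul C
      simpa using this
    have hsq := squeeze_zero (fun k => sq_nonneg (U k y - U k x)) hb hlim
    have := hsq.sqrt
    simp only [Real.sqrt_sq_eq_abs, Real.sqrt_zero] at this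
    exact (tendsto_zero_iff_abs_tendsto_zero _).2 this
  have path : ∀ y, Tendsto (fun k => U k y - U k x₀) atTop (𝓝 0) := fun y => by
    induction hirr x₀ y with
    | refl => simp
    | tail _ hbc ih => simpa using ih.add (edge _ _ hbc)
  refine ⟨fun k => ∑' x, m x * ((U k x - U k x₀) * (U k x - U k x₀)) / c, ?_,
    fun k => h.entropy_le_variance hc (hU k) (h1 k) x₀⟩
  have hdom := tendsto_tsum_of_dominated_convergence (𝓕 := atTop)
    (f := fun k x => m x * ((U k x - U k x₀) * (U k x - U k x₀)) / c) (g := fun _ => (0 : ℝ))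
    (bound := fun x => m x * ((2 * C) * (2 * C) / c))
    (h.hasSum_one.summable.mul_right _) (fun x => ?_) (Eventually.of_forall fun k x => ?_)
  · simpa using hdom
  · simpa using (((path x).mul (path x)).const_mul (m x)).div_const c
  · rw [Real.norm_eq_abs, abs_div, abs_mul, abs_of_pos (h.pos x), abs_of_pos hc, mul_div_assoc]
    refine mul_le_mul_of_nonneg_left (div_le_div_of_nonneg_right ?_ hc.le) (h.pos x).le
    have := (abs_sub (U k x) (U k x₀)).trans
      (add_le_add (abs_le_of_mem_Icc hc (hU k x)) (abs_le_of_mem_Icc hc (hU k x₀)))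
    rw [abs_mul]
    exact mul_le_mul (by linarith) (by linarith) (abs_nonneg _) (by positivity)

/-- The entropy-information inequality implied by the curvature-dimension condition. -/
theorem entropy_le_of_CDUpsilon (h : IsReversible m r) (hirr : Irreducible r) (hc : 0 < c)
    (hu : ∀ x, u x ∈ Set.Icc c C) (h1 : HasSum (fun x => m x * u x) 1)
    {κ δ n : ℝ} (hκ : 0 < κ) (hδ : 0 ≤ δ) (hn : 0 < n)
    (hCD : CDUpsilon r κ fun s => s ^ (1 + δ) / n) {Φ : ℝ → ℝ}
    (hΦ : ∀ a b, 0 ≤ a → a ≤ b → (b - a) / (1 + b) ^ δ ≤ Φ b - Φ a) (x₀ : X) :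
    entropy m u ≤ 4 ^ δ * (1 / κ + n) / 2 * (Φ (fisher m r u) - Φ 0) + 1 := by
  set A := 4 ^ δ * (1 / κ + n) / 2 with hA
  have hA0 : 0 ≤ A := by positivity
  have hI0 := h.fisher_nonneg hc hu
  set I₀ := fisher m r u with hI₀
  have hE0 := h.energy_nonneg u
  set E₀ := energy m r u with hE₀
  have hIδ := Real.rpow_nonneg hI0 δ
  -- One step size `t = w⁻¹` serves two purposes: the first summand gives the smallness needed in
  -- `step_le_sub`, the second keeps the accumulated quadratic error below `1`, the additive
  -- constant of the conclusion.
  set w := 2 * (κ + I₀ ^ δ / n) + E₀ / c with hw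
  have hw0 : 0 < w := by positivity
  set t := w⁻¹ with ht
  have ht0 : 0 < t := inv_pos.2 hw0
  have htw : t * w = 1 := inv_mul_cancel₀ hw0.ne'
  have hcC : c ≤ C := (hu x₀).1.trans (hu x₀).2
  obtain ⟨U, hU0, hU, hstep⟩ := h.exists_iterates ht0.le hcC hu
  have hmass : ∀ k, HasSum (fun x => m x * U k x) 1 := fun k => by
    induction k with
    | zero => rwa [hU0]
    | succ k ih =>
      have := ih.add
        ((h.hasSum_generator fun x => abs_le_of_mem_Icc hc (hU (k + 1) x)).mul_left t)
      rw [mul_zero, add_zero] at this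
      refine this.congr_fun fun x => ?_
      rw [← hstep k x]; ring
  set I : ℕ → ℝ := fun k => fisher m r (U k) with hI
  have hInn : ∀ k, 0 ≤ I k := fun k => h.fisher_nonneg hc (hU k)
  have hIstep : ∀ k, I (k + 1) + 2 * t * (I (k + 1) * (κ + I (k + 1) ^ δ / n)) ≤ I k := fun k => by
    have := h.fisher_step_of_CDUpsilon hc ht0.le (hU (k + 1)) (hU k) (hstep k) (hmass (k + 1))
      hδ hn hCD
    refine le_trans (le_of_eq ?_) this
    simp only [hI]
    rcases eq_or_ne (fisher m r (U (k + 1))) 0 with e | e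
    · rw [e, Real.zero_rpow (by linarith : 1 + δ ≠ 0)]; simp
    · rw [add_comm 1 δ, Real.rpow_add_one e]; ring
  have hIanti : ∀ k, I k ≤ I₀ := fun k => by
    induction k with
    | zero => simp [hI, hU0, hI₀]
    | succ k ih =>
      have h2 := hInn (k + 1)
      have h3 := Real.rpow_nonneg h2 δ
      have : 0 ≤ 2 * t * (I (k + 1) * (κ + I (k + 1) ^ δ / n)) := by positivity
      linarith [hIstep k]
  -- The term with `κ > 0` alone already forces geometric decay.
  have hIgeom : ∀ k, I k ≤ I₀ * ((1 + 2 * t * κ)⁻¹) ^ k := fun k => by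
    induction k with
    | zero => simpa using hIanti 0
    | succ k ih =>
      have hp : 0 < 1 + 2 * t * κ := by positivity
      rw [pow_succ, ← mul_assoc, ← div_eq_mul_inv, le_div_iff₀ hp]
      refine le_trans ?_ ih
      have h2 := hInn (k + 1)
      have h3 := Real.rpow_nonneg h2 δ
      have : 0 ≤ 2 * t * (I (k + 1) * (I (k + 1) ^ δ / n)) := by positivity
      linarith [hIstep k]
  have hIlim : Tendsto I atTop (𝓝 0) := by
    refine squeeze_zero hInn hIgeom ?_
    have hp : 0 < 2 * t * κ := by positivity
    have := (tendsto_pow_atTop_nhds_zero_of_lt_one (r := (1 + 2 * t * κ)⁻¹) (by positivity)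
      (inv_lt_one_of_one_lt₀ (by linarith))).const_mul I₀
    simpa using this
  obtain ⟨b, hb, hbU⟩ := h.exists_entropy_bound_tendsto hirr hc hU hmass hIlim x₀
  have hdrop : ∀ k, t * I (k + 1) ≤ A * (Φ (I k) - Φ (I (k + 1))) := fun k => by
    refine step_le_sub hΦ hκ hδ hn ht0.le (hInn _) ?_ (hIstep k)
    rw [← htw, hw]
    have h2 : I (k + 1) ^ δ / n ≤ I₀ ^ δ / n :=
      div_le_div_of_nonneg_right (Real.rpow_le_rpow (hInn _) (hIanti _) hδ) hn.le
    have h3 : 0 ≤ E₀ / c := by positivity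
    nlinarith
  -- Fisher information and quadratic error both telescope, the first through `Φ`, the second
  -- through the energy.
  have hmain : ∀ N, entropy m u ≤ entropy m (U N) + A * (Φ I₀ - Φ (I N))
      + c⁻¹ * (t / 2 * (E₀ - energy m r (U N))) := fun N => by
    induction N with
    | zero => simp [hI, hU0, hI₀, hE₀]
    | succ N ih =>
      have h2 := h.entropy_step hc (hU (N + 1)) (hU N) (hstep N)
      have h3 := h.energy_step hc ht0 (hU (N + 1)) (hU N) (hstep N)
      set Q := ∑' x, m x * ((U N x - U (N + 1) x) * (U N x - U (N + 1) x)) with hQ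
      have h4 : Q ≤ t / 2 * (energy m r (U N) - energy m r (U (N + 1))) := by
        have : Q = t / 2 * (2 / t * Q) := by field_simp
        rw [this]
        exact mul_le_mul_of_nonneg_left (by linarith) (by positivity)
      have h5 := mul_le_mul_of_nonneg_left h4 (inv_nonneg.2 hc.le)
      have h6 := hdrop N
      simp only [hI] at h6 ih ⊢
      linarith
  have hbound : ∀ N, entropy m u ≤ b N + (A * (Φ I₀ - Φ 0) + 1) := fun N => by
    have h2 : Φ 0 ≤ Φ (I N) := by
      have := hΦ 0 (I N) le_rfl (hInn N)
      have h3 : 0 ≤ (I N - 0) / (1 + I N) ^ δ :=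
        div_nonneg (by linarith [hInn N]) (Real.rpow_nonneg (by linarith [hInn N]) _)
      linarith
    have h3 : c⁻¹ * (t / 2 * (E₀ - energy m r (U N))) ≤ 1 := by
      have h4 := h.energy_nonneg (U N)
      have h5 : c⁻¹ * (t / 2 * (E₀ - energy m r (U N))) ≤ c⁻¹ * (t * E₀) := by
        refine mul_le_mul_of_nonneg_left ?_ (inv_nonneg.2 hc.le)
        nlinarith
      have h6 : c⁻¹ * (t * E₀) = t * (E₀ / c) := by rw [div_eq_mul_inv]; ring
      have h7 : 0 ≤ 2 * (κ + I₀ ^ δ / n) := by positivity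
      have h8 : t * (E₀ / c) ≤ t * w := mul_le_mul_of_nonneg_left (by linarith) ht0.le
      linarith
    have h4 := mul_le_mul_of_nonneg_left (sub_le_sub_left h2 (Φ I₀)) hA0
    linarith [hmain N, hbU N]
  have hlim := hb.add_const (A * (Φ I₀ - Φ 0) + 1)
  rw [zero_add] at hlim
  exact ge_of_tendsto' hlim hbound

end IsReversible

/-! ### Primitives, the peaked density, and lower bounds on the masses. -/

/-- The function on the right is a primitive of the decreasing function `(1 + s) ^ (-δ)`, whence the
bound by the value at `b`. It stays below `0`, so its total increase from `0` is at most `1 / (δ -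
1)`. -/
theorem rpow_primitive {δ : ℝ} (hδ : 1 < δ) (a b : ℝ) (ha : 0 ≤ a) (hab : a ≤ b) :
    (b - a) / (1 + b) ^ δ ≤ -((1 + b) ^ (1 - δ) / (δ - 1)) - -((1 + a) ^ (1 - δ) / (δ - 1)) := by
  have ha1 : 0 < 1 + a := by linarith
  have hb1 : 0 < 1 + b := by linarith
  have hδ' : 0 < δ - 1 := by linarith
  have hz : 0 < (1 + a) / (1 + b) := div_pos ha1 hb1
  have h1 := Real.log_le_sub_one_of_pos hz
  have h2 := Real.add_one_le_exp (Real.log ((1 + a) / (1 + b)) * (1 - δ))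
  rw [← Real.rpow_def_of_pos hz, Real.div_rpow ha1.le hb1.le,
    le_div_iff₀ (Real.rpow_pos_of_pos hb1 _)] at h2
  have hB : 0 < (1 + b) ^ (1 - δ) := Real.rpow_pos_of_pos hb1 _
  have hBe : (1 + b) ^ (1 - δ) = (1 + b) / (1 + b) ^ δ := by
    rw [Real.rpow_sub hb1, Real.rpow_one]
  have h3 : (1 - (1 + a) / (1 + b)) * (δ - 1) * (1 + b) ^ (1 - δ)
      ≤ (1 + a) ^ (1 - δ) - (1 + b) ^ (1 - δ) := by
    have : (1 - (1 + a) / (1 + b)) * (δ - 1) ≤ Real.log ((1 + a) / (1 + b)) * (1 - δ) := by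
      nlinarith
    nlinarith
  have h4 : (1 - (1 + a) / (1 + b)) * (δ - 1) * (1 + b) ^ (1 - δ)
      = (b - a) / (1 + b) ^ δ * (δ - 1) := by
    rw [hBe]; field_simp; ring
  rw [h4, ← le_div_iff₀ hδ'] at h3
  refine h3.trans (le_of_eq ?_)
  ring

/-- The borderline exponent: this primitive is unbounded, so a bound on the Fisher information, and
with it on the rates, becomes necessary for the argument. -/
theorem log_primitive (a b : ℝ) (ha : 0 ≤ a) (hab : a ≤ b) :
    (b - a) / (1 + b) ^ (1 : ℝ) ≤ Real.log (1 + b) - Real.log (1 + a) := by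
  have ha1 : 0 < 1 + a := by linarith
  have hb1 : 0 < 1 + b := by linarith
  have h1 := Real.log_le_sub_one_of_pos (div_pos ha1 hb1)
  rw [Real.log_div ha1.ne' hb1.ne'] at h1
  have : (b - a) / (1 + b) = 1 - (1 + a) / (1 + b) := by field_simp; ring
  rw [Real.rpow_one, this]
  linarith

namespace IsReversible

variable {m : X → ℝ} {r : X → X → ℝ}

theorem le_one (h : IsReversible m r) (x : X) : m x ≤ 1 :=
  le_hasSum h.hasSum_one x fun y _ => (h.pos y).le

theorem finite_of_le (h : IsReversible m r) {ε : ℝ} (hε : 0 < ε) (hm : ∀ x, ε ≤ m x) :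
    Finite X := by
  have := h.hasSum_one.summable.tendsto_cofinite_zero.eventually (gt_mem_nhds hε)
  rw [Filter.eventually_cofinite] at this
  rw [← Set.finite_univ_iff]
  exact this.subset fun x _ => not_lt.2 (hm x)

/-- Half the constant density plus half the normalized point mass at `x₀`: its entropy is of order
`log (1 / m x₀)`, its Fisher information is controlled by `deg r x₀` times the same logarithm. -/
theorem exists_peaked_density (h : IsReversible m r) (x₀ : X) :
    ∃ (a C : ℝ) (u : X → ℝ), 1 ≤ a ∧ a⁻¹ ≤ 2 * m x₀ ∧ (∀ x, u x ∈ Set.Icc (1 / 2) C) ∧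
      HasSum (fun x => m x * u x) 1 ∧ (Real.log a - Real.log 2) / 2 ≤ entropy m u ∧
      fisher m r u ≤ deg r x₀ * (Real.log a + Real.log 2) / 2 := by
  classical
  have hm := h.pos x₀
  have hm1 := h.le_one x₀
  -- The value at `x₀` that gives total mass one when the density is `1 / 2` elsewhere.
  set a := 1 / 2 + 1 / (2 * m x₀) with ha
  have hma : m x₀ * a = m x₀ / 2 + 1 / 2 := by rw [ha]; field_simp
  have ha1 : 1 ≤ a := by
    by_contra hlt
    push Not at hlt
    nlinarith
  have hinv : a⁻¹ ≤ 2 * m x₀ := by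
    rw [inv_le_iff_one_le_mul₀ (by linarith)]; nlinarith
  let u : X → ℝ := fun x => if x = x₀ then a else 1 / 2
  have hu : ∀ x, u x ∈ Set.Icc (1 / 2) a := fun x => by
    simp only [u]; split_ifs <;> constructor <;> linarith
  have hφ : ∀ (φ : ℝ → ℝ) (b : X → ℝ) (s : ℝ), HasSum b s →
      HasSum (fun x => b x * φ (u x)) (s * φ (1 / 2) + b x₀ * (φ a - φ (1 / 2))) := by
    intro φ b s hb
    refine ((hb.mul_right (φ (1 / 2))).add
      (hasSum_ite_eq x₀ (b x₀ * (φ a - φ (1 / 2))))).congr_fun fun x => ?_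
    simp only [u]
    split_ifs with e
    · subst e; ring
    · ring
  have hlog2 : Real.log (1 / 2) = -Real.log 2 := by rw [one_div, Real.log_inv]
  have hloga : 0 ≤ Real.log a := Real.log_nonneg ha1
  have hl2 : 0 ≤ Real.log 2 := Real.log_nonneg (by norm_num)
  refine ⟨a, a, u, ha1, hinv, hu, ?_, ?_, ?_⟩
  · have h1 := hφ (fun s => s) m 1 h.hasSum_one
    have e : 1 * (1 / 2) + m x₀ * (a - 1 / 2) = 1 := by linarith
    rwa [e] at h1
  · rw [entropy, (hφ (fun s => s * Real.log s) m 1 h.hasSum_one).tsum_eq, hlog2]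
    have : m x₀ * (a * Real.log a) = (m x₀ / 2 + 1 / 2) * Real.log a := by rw [← hma]; ring
    nlinarith [mul_nonneg hm.le hloga, mul_nonneg hm.le hl2]
  -- The weights `m * L u` have sum zero, so in `∑ m (log u) (L u)` only the jump of `log u` at `x₀`
  -- survives.
  · have h1 := hφ Real.log _ 0 (h.hasSum_generator fun x => abs_le_of_mem_Icc (by norm_num) (hu x))
    have h2 := (h.fisher_eq (by norm_num) hu).2.1
    have h3 := h1.unique (h2.congr_fun fun x => by ring)
    rw [hlog2] at h3
    have h4 : -(generator r u x₀) ≤ 1 / (2 * m x₀) * deg r x₀ := by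
      have hs := h.summable_generator (fun x => abs_le_of_mem_Icc (by norm_num) (hu x)) x₀
      rw [generator, ← tsum_neg, deg, ← tsum_mul_left]
      refine hs.neg.tsum_le_tsum (fun y => ?_) ((h.row x₀).mul_left _)
      have : u x₀ - u y ≤ 1 / (2 * m x₀) := by
        have e : u x₀ = a := by simp [u]
        rw [e]; linarith [(hu y).1]
      nlinarith [h.rate_nonneg x₀ y]
    have h5 : m x₀ * -(generator r u x₀) ≤ deg r x₀ / 2 := by
      have := mul_le_mul_of_nonneg_left h4 hm.le
      have e : m x₀ * (1 / (2 * m x₀) * deg r x₀) = deg r x₀ / 2 := by field_simp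
      linarith
    have h6 := mul_le_mul_of_nonneg_right h5 (add_nonneg hloga hl2)
    linarith

/-- A superquadratic dimension term forces finiteness. -/
theorem finite_of_one_lt (h : IsReversible m r) (hirr : Irreducible r) {κ δ n : ℝ} (hκ : 0 < κ)
    (hδ : 1 < δ) (hn : 0 < n) (hCD : CDUpsilon r κ fun s => s ^ (1 + δ) / n) : Finite X := by
  set K := 4 ^ δ * (1 / κ + n) / 2 * (1 / (δ - 1)) + 1 with hK
  have hbound : ∀ x, Real.exp (-(2 * K + Real.log 2)) / 2 ≤ m x := fun x => by
    obtain ⟨a, C, u, ha, hinv, hu, h1, hent, -⟩ := h.exists_peaked_density x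
    have hc : (0 : ℝ) < 1 / 2 := by norm_num
    have hmain := h.entropy_le_of_CDUpsilon hirr hc hu h1 hκ (by linarith) hn hCD
      (rpow_primitive hδ) x
    have hI := h.fisher_nonneg hc hu
    have h2 : -((1 + fisher m r u) ^ (1 - δ) / (δ - 1)) - -((1 + 0) ^ (1 - δ) / (δ - 1))
        ≤ 1 / (δ - 1) := by
      have := div_nonneg (Real.rpow_nonneg (by linarith : 0 ≤ 1 + fisher m r u) (1 - δ))
        (by linarith : 0 ≤ δ - 1)
      rw [add_zero, Real.one_rpow]
      linarith
    have h3 := mul_le_mul_of_nonneg_left h2 (by positivity : 0 ≤ 4 ^ δ * (1 / κ + n) / 2)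
    have h4 : Real.log a ≤ 2 * K + Real.log 2 := by linarith
    have h5 : Real.exp (-(2 * K + Real.log 2)) ≤ a⁻¹ := by
      rw [Real.exp_neg]
      refine inv_anti₀ (by linarith) ?_
      rwa [← Real.log_le_iff_le_exp (by linarith)]
    linarith
  exact h.finite_of_le (by positivity) hbound

/-- A quadratic dimension term and bounded total rates force finiteness. -/
theorem finite_of_deg_le (h : IsReversible m r) (hirr : Irreducible r) {κ n M : ℝ} (hκ : 0 < κ)
    (hn : 0 < n) (hCD : CDUpsilon r κ fun s => s ^ (1 + (1 : ℝ)) / n) (hM : ∀ x, deg r x ≤ M) :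
    Finite X := by
  set A := (4 : ℝ) ^ (1 : ℝ) * (1 / κ + n) / 2 with hA
  have hA0 : 0 < A := by positivity
  set M' := max M 0 with hM'
  have hM0 : 0 ≤ M' := le_max_right _ _
  -- The logarithm is linearized at `s`. This choice makes the resulting slope in `log a` at most `1
  -- / 4`, which the `1 / 2` on the entropy side absorbs.
  set s := 2 * (A * M') + 1 with hs
  have hs0 : 0 < s := by positivity
  set K := 4 * (Real.log 2 / 2 + 1 + A * Real.log s + A / s) + Real.log 2 with hK
  have hbound : ∀ x, Real.exp (-K) / 2 ≤ m x := fun x => by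
    obtain ⟨a, C, u, ha, hinv, hu, h1, hent, hfis⟩ := h.exists_peaked_density x
    have hc : (0 : ℝ) < 1 / 2 := by norm_num
    have hmain := h.entropy_le_of_CDUpsilon hirr hc hu h1 hκ zero_le_one hn hCD log_primitive x
    have hI := h.fisher_nonneg hc hu
    have hloga : 0 ≤ Real.log a := Real.log_nonneg ha
    have hl2 : 0 ≤ Real.log 2 := Real.log_nonneg (by norm_num)
    have hfis' : fisher m r u ≤ M' * (Real.log a + Real.log 2) / 2 := by
      refine hfis.trans ?_
      have := mul_le_mul_of_nonneg_right ((hM x).trans (le_max_left M 0))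
        (add_nonneg hloga hl2)
      linarith
    have hI1 : 0 < 1 + fisher m r u := by linarith
    have h2 := Real.log_le_sub_one_of_pos (div_pos hI1 hs0)
    rw [Real.log_div hI1.ne' hs0.ne'] at h2
    have h3 : A * Real.log (1 + fisher m r u)
        ≤ A * Real.log s + A / s + (Real.log a + Real.log 2) / 4 := by
      have h4 : A * (fisher m r u / s) ≤ (Real.log a + Real.log 2) / 4 := by
        rw [← mul_div_assoc, div_le_iff₀ hs0]
        have h5 := mul_le_mul_of_nonneg_left hfis' hA0.le
        nlinarith
      have h6 : A * ((1 + fisher m r u) / s) = A / s + A * (fisher m r u / s) := by ring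
      nlinarith
    have h4 : Real.log a ≤ K := by
      rw [add_zero, Real.log_one, sub_zero, ← hA] at hmain
      linarith
    have h5 : Real.exp (-K) ≤ a⁻¹ := by
      rw [Real.exp_neg]
      refine inv_anti₀ (by linarith) ?_
      rwa [← Real.log_le_iff_le_exp (by linarith)]
    linarith
  exact h.finite_of_le (by positivity) hbound

end IsReversible

/-! ### Reduction to off-diagonal rates and conclusion. -/

open Classical in
/-- The jump rates off the diagonal. -/
noncomputable def offDiag (k : X → X → ℝ) (x y : X) : ℝ := if y = x then 0 else k x y

/-- All the operators multiply `k x y` by a factor that vanishes for `y = x`, so the negative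
diagonal can be discarded and the rates taken nonnegative. -/
theorem offDiag_mul (k : X → X → ℝ) {x y : X} {a : ℝ} (ha : y = x → a = 0) :
    offDiag k x y * a = k x y * a := by
  by_cases e : y = x <;> simp [offDiag, e, ha]

theorem generator_offDiag (k : X → X → ℝ) : generator (offDiag k) = generator k := by
  ext f x
  exact tsum_congr fun y => offDiag_mul k fun e => by simp [e]

theorem Psi_offDiag (k : X → X → ℝ) {H : ℝ → ℝ} (hH : H 0 = 0) : Psi (offDiag k) H = Psi k H := by
  ext f x
  exact tsum_congr fun y => offDiag_mul k fun e => by simp [e, hH]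

theorem B_offDiag (k : X → X → ℝ) (H : ℝ → ℝ) : B (offDiag k) H = B k H := by
  ext f g x
  refine tsum_congr fun y => ?_
  rw [mul_assoc, mul_assoc]
  exact offDiag_mul k fun e => by simp [e]

theorem CDUpsilon_offDiag (k : X → X → ℝ) (κ : ℝ) (F : ℝ → ℝ) :
    CDUpsilon (offDiag k) κ F ↔ CDUpsilon k κ F := by
  have : Upsilon 0 = 0 := by simp [Upsilon]
  simp only [CDUpsilon, Psi₂, generator_offDiag, Psi_offDiag k this, B_offDiag]

theorem deg_offDiag (k : X → X → ℝ) : deg (offDiag k) = M₁ k := by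
  ext x
  rw [deg, M₁, tsum_subtype ({x}ᶜ : Set X) (k x)]
  refine tsum_congr fun y => ?_
  by_cases e : y = x <;> simp [offDiag, e]

theorem IsRateMatrix.diag_nonpos {k : X → X → ℝ} (hk : IsRateMatrix k) (x : X) : k x x ≤ 0 := by
  classical
  have h := hk.row_sum x
  -- With the diagonal entry set to zero the row is nonnegative and sums to `-k x x`.
  have h0 := h.update x 0
  have := h0.nonneg fun y => by
    rcases eq_or_ne y x with rfl | e
    · simp
    · simpa [e] using hk.nonneg x y e.symm
  linarith

theorem IsRateMatrix.irreducible_offDiag {k : X → X → ℝ} (hk : IsRateMatrix k)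
    (hirr : Irreducible k) : Irreducible (offDiag k) := fun x y =>
  Relation.ReflTransGen.mono (fun a b (hab : 0 < k a b) => by
    have : b ≠ a := fun e => by subst e; exact absurd hab (not_lt.2 (hk.diag_nonpos b))
    simpa [offDiag, this] using hab) _ _ (hirr x y)

theorem IsRateMatrix.isReversible [Countable X] [MeasurableSpace X] [DiscreteMeasurableSpace X]
    {k : X → X → ℝ} (hk : IsRateMatrix k) (hirr : Irreducible k) (μ : Measure X)
    [IsProbabilityMeasure μ] (hμ : DetailedBalance k μ) (hM₁ : MemLp (M₁ k) 2 μ) :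
    IsReversible (fun x => μ.real {x}) (offDiag k) := by
  have hint : ∀ f : X → ℝ, Integrable f μ → Summable fun x => μ.real {x} * f x := fun f hf => by
    rw [← Measure.sum_smul_dirac μ] at hf
    refine Summable.of_norm (hf.summable_of_dirac.congr fun x => ?_)
    rw [norm_mul, Real.norm_of_nonneg measureReal_nonneg]; rfl
  have hsum : HasSum (fun x => μ.real {x}) 1 := by
    have h1 := (hint (fun _ => 1) (integrable_const 1)).hasSum
    have h2 := integral_countable (μ := μ) (f := fun _ : X => (1 : ℝ)) (integrable_const 1)
    simp only [smul_eq_mul, integral_const, probReal_univ, mul_one] at h1 h2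
    rwa [← h2] at h1
  have hne : ∃ x₀, μ.real {x₀} ≠ 0 := by
    by_contra hcon
    push Not at hcon
    simp only [hcon] at hsum
    exact zero_ne_one (hasSum_zero.unique hsum)
  obtain ⟨x₀, hx₀⟩ := hne
  -- Detailed balance carries positive mass along each edge of positive rate, so irreducibility
  -- spreads it from `x₀` to every state.
  have hpos : ∀ x, 0 < μ.real {x} := fun x => by
    induction hirr x₀ x with
    | refl => exact lt_of_le_of_ne measureReal_nonneg hx₀.symm
    | @tail b c _ hbc ih =>
      refine lt_of_le_of_ne measureReal_nonneg fun e => ?_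
      have := hμ b c
      rw [← e, zero_mul] at this
      exact (mul_pos ih hbc).ne' this
  refine ⟨hpos, hsum, fun x y => ?_, fun x => ?_, fun x y => ?_, ?_⟩
  · by_cases e : y = x
    · simp [offDiag, e]
    · simpa [offDiag, e] using hk.nonneg x y (Ne.symm e)
  · classical
    refine ((hk.row_sum x).update x 0).summable.congr fun y => ?_
    by_cases e : y = x <;> simp [offDiag, e]
  · by_cases e : y = x
    · subst e; rfl
    · simpa [offDiag, e, Ne.symm e] using hμ x y
  · refine (hint _ hM₁.integrable_sq).congr fun x => ?_
    have := congrFun (deg_offDiag k) x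
    rw [← this]; rfl

end MarkovCD

/-- Reversibility with `M₁ ∈ ℓ²(μ)` already makes implicit Euler steps of the semigroup conservative
and yields `M₂ ∈ ℓ¹(μ)`, so the hypotheses on `M₂` and on the recurrence of the chain are not used. -/
theorem mainTheorem11 {X : Type*} [Countable X] [MeasurableSpace X] [DiscreteMeasurableSpace X]
    (k : X → X → ℝ) (hk : MarkovCD.IsRateMatrix k) (hirr : MarkovCD.Irreducible k)
    (hM₂fin : MarkovCD.M₂Finite k)
    (μ : Measure X) [IsProbabilityMeasure μ] (hμ : MarkovCD.DetailedBalance k μ)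
    (hM₁ : MemLp (MarkovCD.M₁ k) 2 μ) (hM₂ : MemLp (MarkovCD.M₂ k) 1 μ)
    {Ω : Type*} [MeasurableSpace Ω] (P : X → Measure Ω) (Y : ℕ → Ω → X) (S : ℕ → Ω → ℝ≥0∞)
    (hZ : MarkovCD.IsMarkovChain k P Y S) (hrec : MarkovCD.PositiveRecurrent k P Y S)
    (κ δ n : ℝ) (hκ : 0 < κ) (hδ : 1 ≤ δ) (hn : 0 < n)
    (hCD : MarkovCD.CDUpsilon k κ (fun r => r ^ (1 + δ) / n)) :
    Finite X ↔ (1 < δ ∨ (δ = 1 ∧ MarkovCD.M₁sup k < ⊤)) := by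
  have h := hk.isReversible hirr μ hμ hM₁
  have hirr' := hk.irreducible_offDiag hirr
  rw [← MarkovCD.CDUpsilon_offDiag] at hCD
  constructor
  · intro hfin
    rcases hδ.lt_or_eq with hlt | rfl
    · exact Or.inl hlt
    · refine Or.inr ⟨rfl, ?_⟩
      obtain ⟨M, hM⟩ := (Set.finite_range (MarkovCD.M₁ k)).bddAbove
      exact (iSup_le fun x => ENNReal.ofReal_le_ofReal (hM (Set.mem_range_self x))).trans_lt
        ENNReal.ofReal_lt_top
  · rintro (hlt | ⟨rfl, hsup⟩)
    · exact h.finite_of_one_lt hirr' hκ hlt hn hCD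
    · refine h.finite_of_deg_le hirr' hκ hn hCD (M := (MarkovCD.M₁sup k).toReal) fun x => ?_
      rw [MarkovCD.deg_offDiag, ← ENNReal.ofReal_le_iff_le_toReal hsup.ne]
      exact le_iSup (fun x => ENNReal.ofReal (MarkovCD.M₁ k x)) x
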